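/- Let $n\in\mathbb N$, $S\subseteq\{0,1\}^n$ and $f:S\to\{0,1\}$, and let $\epsilon<1/2$ be real. Definitions. A (Boolean) formula is a binary tree whose internal nodes are labelled by $\vee$ or $\wedge$ and whose leaves are labelled by literals $x_i$ or $\neg x_i$, $i\in[n]$; its size is its number of leaves. For $g:S\to\{0,1\}$ let $\mathsf L(g)$ be the least size of a formula that agrees with $g$ on $S$. We say that $f$ is $\epsilon$-approximated by a family $\{g_j\}_{j\in J}$ of functions $g_j:S\to\{0,1\}$ if there is a probability distribution $\alpha$ on $J$ such that $\Pr_{j\sim\alpha}[f(x)=g_j(x)]\ge 1-\epsilon$ for every $x\in S$. The $\epsilon$-probabilistic formula size $\mathsf L^{\epsilon}(f)$ is the least $s\in\mathbb N$ such that $f$ is $\epsilon$-approximated by some family $\{g_j\}_{j\in J}$ with $\mathsf L(g_j)\le s$ for every $j\in J$. (Both sizes are $\infty$ if there is no such formula or no such $s$.) Finally, $$\mathsf{sumPI}(f)=\min_{p}\ \max_{\substack{x,y\in S\\ f(x)\ne f(y)}}\ \frac{1}{\sum_{i:\,x_i\ne y_i}\sqrt{p_x(i)\,p_y(i)}}\in[0,\infty],$$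 where $p=\{p_x\}_{x\in S}$ ranges over the families of probability distributions on $[n]$, $1/0=\infty$, the maximum is $0$ if $f$ is constant, and the minimum over the empty set of families ($n=0$, $S\neq\emptyset$) is $\infty$. Theorem. 1. If $f$ is $\epsilon$-approximated by a family $\{g_j\}_{j\in J}$ of functions $g_j:S\to\{0,1\}$, and $\mathsf{sumPI}(g_j)\le s$ for every $j\in J$, where $s\in[0,\infty]$, then $\mathsf{sumPI}(f)\le s/(1-2\epsilon)$. 2. $\mathsf L^{\epsilon}(f)\ \ge\ \bigl((1-2\epsilon)\,\mathsf{sumPI}(f)\bigr)^2$. -/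

import Mathlib

open scoped ENNReal

/-- A Boolean formula over `{∨, ∧, ¬}` in the variables `x_i`, `i : Fin n`: a binary tree whose
internal nodes are labelled by `∧` or `∨` and whose leaves are labelled by literals. -/
inductive BoolFormula (n : ℕ) : Type
  | pos (i : Fin n) : BoolFormula n
  | neg (i : Fin n) : BoolFormula n
  | and (φ ψ : BoolFormula n) : BoolFormula n
  | or (φ ψ : BoolFormula n) : BoolFormula n

/-- The function computed by a formula. -/
def BoolFormula.eval {n : ℕ} : BoolFormula n → (Fin n → Bool) → Bool
  | .pos i, x => x i
  | .neg i, x => !(x i)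
  | .and φ ψ, x => φ.eval x && ψ.eval x
  | .or φ ψ, x => φ.eval x || ψ.eval x

/-- The size of a formula is its number of leaves. -/
def BoolFormula.size {n : ℕ} : BoolFormula n → ℕ
  | .pos _ => 1
  | .neg _ => 1
  | .and φ ψ => φ.size + ψ.size
  | .or φ ψ => φ.size + ψ.size

/-- A formula computes `f : S → {0,1}` if it agrees with `f` on all of `S`. -/
def BoolFormula.Computes {n : ℕ} {S : Set (Fin n → Bool)} (φ : BoolFormula n) (f : S → Bool) :
    Prop :=
  ∀ x : S, φ.eval x.1 = f x

/-- The formula size `L(f)`: the least size of a formula computing `f`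
(`⊤` if there is none, which happens only for `n = 0`). -/
noncomputable def formulaSize {n : ℕ} {S : Set (Fin n → Bool)} (f : S → Bool) : ℕ∞ :=
  ⨅ (φ : BoolFormula n) (_ : φ.Computes f), (φ.size : ℕ∞)

/-- `f` is `ε`-approximated by the family `g`: for some probability distribution `α` on `J`,
for every `x ∈ S`, the probability that `f x = g j x` is at least `1 - ε`. -/
def IsApproximatedBy {n : ℕ} {S : Set (Fin n → Bool)} {J : Type*} (ε : ℝ) (f : S → Bool)
    (g : J → S → Bool) : Prop :=
  ∃ α : PMF J, ∀ x : S, ENNReal.ofReal (1 - ε) ≤ α.toOuterMeasure {j | f x = g j x}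

/-- The `ε`-probabilistic formula size `L^ε(f)`: the least `s` such that `f` is `ε`-approximated
by a family of functions of formula size at most `s` (`⊤` if there is none). -/
noncomputable def probFormulaSize {n : ℕ} {S : Set (Fin n → Bool)} (ε : ℝ) (f : S → Bool) : ℕ∞ :=
  ⨅ (s : ℕ) (_ : ∃ (J : Type) (g : J → S → Bool),
    IsApproximatedBy ε f g ∧ ∀ j, formulaSize (g j) ≤ (s : ℕ∞)), (s : ℕ∞)

/-- `sumPI(f) = min_p max_{f x ≠ f y} 1 / ∑_{i : x_i ≠ y_i} √(p_x(i) p_y(i))`, where `p` ranges over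
the families, indexed by `S`, of probability distributions on the `n` indices. It takes values in
`[0, ∞]`, with `1 / 0 = ∞`, and an empty maximum (constant `f`) is `0`. -/
noncomputable def sumPI {n : ℕ} {S : Set (Fin n → Bool)} (f : S → Bool) : ℝ≥0∞ :=
  ⨅ p : S → stdSimplex ℝ (Fin n), ⨆ (x : S) (y : S) (_ : f x ≠ f y),
    (ENNReal.ofReal (∑ i with x.1 i ≠ y.1 i, √((p x).1 i * (p y).1 i)))⁻¹

/-! Part 1: give each `g j` a near-optimal family of distributions and average these families with
the weights of `α`. By Cauchy-Schwarz the overlap of the averages is at least the average overlap.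
If `f x ≠ f y`, every `g j` agreeing with `f` at both points separates them; this has probability at
least `1 - 2 * ε`, and each such `j` contributes about `1 / s`. Part 2 combines this with `sumPI g ≤
√L(g)`, proved by induction on formulas (`exists_overlap_of_gate`). -/

theorem sumPI_le_of_forall_inv_le {n : ℕ} {S : Set (Fin n → Bool)} {f : S → Bool} {t : ℝ≥0∞}
    (p : S → stdSimplex ℝ (Fin n))
    (hp : ∀ x y : S, f x ≠ f y →
      t⁻¹ ≤ ENNReal.ofReal (∑ i with x.1 i ≠ y.1 i, √((p x).1 i * (p y).1 i))) :
    sumPI f ≤ t :=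
  iInf_le_of_le p <| iSup_le fun x => iSup_le fun y => iSup_le fun h =>
    ENNReal.inv_le_iff_inv_le.mp (hp x y h)

theorem exists_forall_inv_le_of_sumPI_lt {n : ℕ} {S : Set (Fin n → Bool)} {f : S → Bool}
    {t : ℝ≥0∞} (h : sumPI f < t) :
    ∃ p : S → stdSimplex ℝ (Fin n), ∀ x y : S, f x ≠ f y →
      t⁻¹ ≤ ENNReal.ofReal (∑ i with x.1 i ≠ y.1 i, √((p x).1 i * (p y).1 i)) := by
  obtain ⟨p, hp⟩ := iInf_lt_iff.mp h
  refine ⟨p, fun x y hxy => ENNReal.inv_le_iff_inv_le.mp (le_trans ?_ hp.le)⟩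
  exact le_iSup_of_le x <| le_iSup_of_le y <| le_iSup_of_le hxy le_rfl

/-- Averaging two nonnegative families with the same weights can only increase the geometric mean
(Cauchy-Schwarz). -/
theorem sum_mul_sqrt_le_sqrt_sum_mul_sum {ι : Type*} (s : Finset ι) (w a b : ι → ℝ)
    (hw : ∀ i, 0 ≤ w i) (ha : ∀ i, 0 ≤ a i) (hb : ∀ i, 0 ≤ b i) :
    ∑ i ∈ s, w i * √(a i * b i) ≤ √((∑ i ∈ s, w i * a i) * ∑ i ∈ s, w i * b i) := by
  rw [Real.sqrt_mul (Finset.sum_nonneg fun i _ => mul_nonneg (hw i) (ha i))]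
  refine le_trans (le_of_eq (Finset.sum_congr rfl fun i _ => ?_))
    (Real.sum_sqrt_mul_sqrt_le s (fun i => mul_nonneg (hw i) (ha i))
      (fun i => mul_nonneg (hw i) (hb i)))
  rw [← Real.sqrt_mul (mul_nonneg (hw i) (ha i)),
    show w i * a i * (w i * b i) = w i ^ 2 * (a i * b i) by ring,
    Real.sqrt_mul (sq_nonneg _), Real.sqrt_sq (hw i)]

/-- Union bound: a function agreeing with `f` at both `x` and `y` separates them, and each agreement
fails with weight at most `ε`. -/
theorem le_sum_weights_of_separated {n : ℕ} {S : Set (Fin n → Bool)} [Fintype (S → Bool)]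
    {f : S → Bool} {ε : ℝ}
    (w : (S → Bool) → ℝ) (hw : ∀ h, 0 ≤ w h) (hw1 : ∑ h, w h = 1)
    (hf : ∀ x : S, 1 - ε ≤ ∑ h : S → Bool, if f x = h x then w h else 0)
    {x y : S} (hxy : f x ≠ f y) :
    1 - 2 * ε ≤ ∑ h : S → Bool, if h x ≠ h y then w h else 0 := by
  have key : (∑ h : S → Bool, if f x = h x then w h else 0) +
      (∑ h : S → Bool, if f y = h y then w h else 0) - ∑ h, w h ≤
      ∑ h : S → Bool, if h x ≠ h y then w h else 0 := by
    rw [← Finset.sum_add_distrib, ← Finset.sum_sub_distrib]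
    refine Finset.sum_le_sum fun h _ => ?_
    have := hw h
    by_cases h1 : f x = h x <;> by_cases h2 : f y = h y
    · have h3 : h x ≠ h y := by rwa [← h1, ← h2]
      simp [h1, h2, h3]
    all_goals simp only [h1, h2, if_true, if_false]; split_ifs <;> linarith
  linarith [hf x, hf y]

/-- The mixture, with weights `w`, of a finite family of points of the standard simplex. -/
def simplexMixture {ι κ : Type*} [Fintype ι] [Fintype κ] (w : ι → ℝ) (hw : ∀ j, 0 ≤ w j)
    (hw1 : ∑ j, w j = 1) (q : ι → stdSimplex ℝ κ) : stdSimplex ℝ κ :=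
  ⟨fun i => ∑ j, w j * (q j).1 i,
    fun i => Finset.sum_nonneg fun j _ => mul_nonneg (hw j) ((q j).2.1 i), by
      rw [Finset.sum_comm]
      simp_rw [← Finset.mul_sum]
      rw [← hw1]
      exact Finset.sum_congr rfl fun j _ => by rw [(q j).2.2, mul_one]⟩

theorem sum_mul_overlap_le_overlap_mixture {ι κ : Type*} [Fintype ι] [Fintype κ] (w : ι → ℝ)
    (hw : ∀ j, 0 ≤ w j) (hw1 : ∑ j, w j = 1) (q r : ι → stdSimplex ℝ κ) (A : Finset κ) :
    ∑ j, w j * ∑ i ∈ A, √((q j).1 i * (r j).1 i) ≤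
      ∑ i ∈ A, √((simplexMixture w hw hw1 q).1 i * (simplexMixture w hw hw1 r).1 i) := by
  simp_rw [Finset.mul_sum]
  rw [Finset.sum_comm]
  exact Finset.sum_le_sum fun i _ => sum_mul_sqrt_le_sqrt_sum_mul_sum _ w _ _ hw
    (fun j => (q j).2.1 i) (fun j => (r j).2.1 i)

/-- `J` is arbitrary but `S → Bool` is finite, so pushing `α` forward along `g` leaves only finite
sums. -/
theorem IsApproximatedBy.exists_weights {n : ℕ} {S : Set (Fin n → Bool)} [Fintype (S → Bool)]
    {J : Type*} {ε : ℝ} {f : S → Bool} {g : J → S → Bool} (h : IsApproximatedBy ε f g) :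
    ∃ w : (S → Bool) → ℝ, (∀ u, 0 ≤ w u) ∧ ∑ u, w u = 1 ∧ (∀ u, w u ≠ 0 → ∃ j, g j = u) ∧
      ∀ x : S, 1 - ε ≤ ∑ u : S → Bool, if f x = u x then w u else 0 := by
  obtain ⟨α, hα⟩ := h
  refine ⟨fun u => (α.map g u).toReal, fun u => ENNReal.toReal_nonneg, ?_, ?_, fun x => ?_⟩
  · rw [← ENNReal.toReal_sum fun u _ => PMF.apply_ne_top _ _,
      ← tsum_fintype (L := .unconditional _), PMF.tsum_coe, ENNReal.toReal_one]
  · intro u hu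
    have hu' : u ∈ (α.map g).support := by
      rw [PMF.mem_support_iff]
      exact fun h0 => hu (by simp [h0])
    obtain ⟨j, -, hj⟩ := (PMF.mem_support_map_iff _ _ _).mp hu'
    exact ⟨j, hj⟩
  · have hx : ENNReal.ofReal (1 - ε) ≤ (α.map g).toOuterMeasure {u | f x = u x} := by
      rw [PMF.toOuterMeasure_map_apply]
      exact hα x
    rw [PMF.toOuterMeasure_apply_fintype] at hx
    have hfin : ∀ u ∈ (Finset.univ : Finset (S → Bool)),
        ({u | f x = u x} : Set (S → Bool)).indicator (α.map g) u ≠ ⊤ := fun u _ =>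
      ne_top_of_le_ne_top (PMF.apply_ne_top (α.map g) u) (Set.indicator_le_self _ _ u)
    have := (ENNReal.ofReal_le_iff_le_toReal (ENNReal.sum_ne_top.mpr hfin)).mp hx
    rw [ENNReal.toReal_sum hfin] at this
    refine this.trans (le_of_eq (Finset.sum_congr rfl fun u _ => ?_))
    by_cases h1 : f x = u x <;> simp [Set.indicator, h1]

theorem sumPI_le_of_isApproximatedBy_of_lt {n : ℕ} {S : Set (Fin n → Bool)} {J : Type*} {ε : ℝ}
    (hε : ε < 1 / 2) {f : S → Bool} {g : J → S → Bool} {t : ℝ≥0∞}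
    (h : IsApproximatedBy ε f g) (hg : ∀ j, sumPI (g j) < t) :
    sumPI f ≤ t / ENNReal.ofReal (1 - 2 * ε) := by
  have := Fintype.ofFinite (S → Bool)
  choose p hp using fun j => exists_forall_inv_le_of_sumPI_lt (hg j)
  obtain ⟨w, hw, hw1, hwg, hwf⟩ := IsApproximatedBy.exists_weights h
  have hJ : Nonempty J := by
    by_contra hJ
    have : ∀ u, w u = 0 := fun u => by
      by_contra hu
      obtain ⟨j, -⟩ := hwg u hu
      exact hJ ⟨j⟩
    simp [this] at hw1
  have ht : t ≠ 0 := (bot_le.trans_lt (hg hJ.some)).ne'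
  have hε' : ENNReal.ofReal (1 - 2 * ε) ≠ 0 := by
    rw [Ne, ENNReal.ofReal_eq_zero, not_le]
    linarith
  -- One index represents each function `u`; outside the range of `g` the choice is junk, but there
  -- `w u = 0`.
  let q : S → (S → Bool) → stdSimplex ℝ (Fin n) := fun x u => p (Function.invFun g u) x
  refine sumPI_le_of_forall_inv_le (fun x => simplexMixture w hw hw1 (q x)) fun x y hxy => ?_
  rw [ENNReal.inv_div (Or.inl ENNReal.ofReal_ne_top) (Or.inl hε'), div_eq_mul_inv,
    ← ENNReal.ofReal_toReal (ENNReal.inv_ne_top.mpr ht), ← ENNReal.ofReal_mul (by linarith)]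
  refine ENNReal.ofReal_le_ofReal ?_
  refine le_trans ?_ (sum_mul_overlap_le_overlap_mixture w hw hw1 (q x) (q y) _)
  refine (mul_le_mul_of_nonneg_right (le_sum_weights_of_separated w hw hw1 hwf hxy)
    ENNReal.toReal_nonneg).trans ?_
  rw [Finset.sum_mul]
  refine Finset.sum_le_sum fun u _ => ?_
  have hpos : 0 ≤ ∑ i with x.1 i ≠ y.1 i, √((q x u).1 i * (q y u).1 i) :=
    Finset.sum_nonneg fun i _ => Real.sqrt_nonneg _
  by_cases hu : u x ≠ u y
  · rw [if_pos hu]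
    by_cases h0 : w u = 0
    · simp [h0]
    · refine mul_le_mul_of_nonneg_left (ENNReal.toReal_le_of_le_ofReal hpos ?_) (hw u)
      have hinv : g (Function.invFun g u) = u := Function.invFun_eq (hwg u h0)
      exact hp (Function.invFun g u) x y (by rwa [hinv])
  · rw [if_neg hu, zero_mul]
    exact mul_nonneg (hw u) hpos

theorem sumPI_le_of_isApproximatedBy {n : ℕ} {S : Set (Fin n → Bool)} {J : Type*} {ε : ℝ}
    (hε : ε < 1 / 2) {f : S → Bool} {g : J → S → Bool} {s : ℝ≥0∞}
    (h : IsApproximatedBy ε f g) (hg : ∀ j, sumPI (g j) ≤ s) :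
    sumPI f ≤ s / ENNReal.ofReal (1 - 2 * ε) := by
  have hε' : ENNReal.ofReal (1 - 2 * ε) ≠ 0 := by
    rw [Ne, ENNReal.ofReal_eq_zero, not_le]
    linarith
  rw [ENNReal.le_div_iff_mul_le (Or.inl hε') (Or.inl ENNReal.ofReal_ne_top)]
  -- Working with every `t > s` avoids showing that the minimum in `sumPI` is attained.
  refine le_of_forall_gt_imp_ge_of_dense fun t ht => ?_
  rw [← ENNReal.le_div_iff_mul_le (Or.inl hε') (Or.inl ENNReal.ofReal_ne_top)]
  exact sumPI_le_of_isApproximatedBy_of_lt hε h fun j => (hg j).trans_lt ht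

/-- The inductive step for a gate at which `f` takes the value `c` exactly where both of its inputs
`u`, `v` do. -/
theorem exists_overlap_of_gate {n : ℕ} {S : Set (Fin n → Bool)} {f u v : S → Bool} (c : Bool)
    (hf : ∀ x, f x = c ↔ u x = c ∧ v x = c) {a b : ℝ} (ha : 0 < a) (hb : 0 < b)
    (hu : ∃ p : S → stdSimplex ℝ (Fin n), ∀ x y : S, u x ≠ u y →
      (√a)⁻¹ ≤ ∑ i with x.1 i ≠ y.1 i, √((p x).1 i * (p y).1 i))
    (hv : ∃ p : S → stdSimplex ℝ (Fin n), ∀ x y : S, v x ≠ v y →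
      (√b)⁻¹ ≤ ∑ i with x.1 i ≠ y.1 i, √((p x).1 i * (p y).1 i)) :
    ∃ p : S → stdSimplex ℝ (Fin n), ∀ x y : S, f x ≠ f y →
      (√(a + b))⁻¹ ≤ ∑ i with x.1 i ≠ y.1 i, √((p x).1 i * (p y).1 i) := by
  obtain ⟨p, hp⟩ := hu
  obtain ⟨q, hq⟩ := hv
  have hab : 0 < a + b := add_pos ha hb
  let m : S → stdSimplex ℝ (Fin n) := fun x =>
    ⟨(a / (a + b)) • (p x).1 + (b / (a + b)) • (q x).1,
      convex_stdSimplex ℝ (Fin n) (p x).2 (q x).2 (by positivity) (by positivity) (by field_simp)⟩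
  -- Where `f x = c` both inputs may be needed, so mix in proportion to `a` and `b`; elsewhere
  -- follow an input whose value is not `c`. The overlap is then at least `√(a / (a + b)) / √a = 1 /
  -- √(a + b)`, or likewise with `b`.
  let r : S → stdSimplex ℝ (Fin n) := fun x =>
    if f x = c then m x else if u x = c then q x else p x
  have scale : ∀ (d : ℝ) (P Q M : Fin n → ℝ) (A : Finset (Fin n)), 0 < d →
      (∀ i, 0 ≤ Q i) → (∀ i, d / (a + b) * P i ≤ M i) →
      (√d)⁻¹ ≤ ∑ i ∈ A, √(P i * Q i) → (√(a + b))⁻¹ ≤ ∑ i ∈ A, √(M i * Q i) := by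
    intro d P Q M A hd hQ hM hPQ
    calc (√(a + b))⁻¹ = √(d / (a + b)) * (√d)⁻¹ := by
          rw [Real.sqrt_div hd.le]
          have := Real.sqrt_pos.mpr hd
          field_simp
      _ ≤ √(d / (a + b)) * ∑ i ∈ A, √(P i * Q i) :=
          mul_le_mul_of_nonneg_left hPQ (Real.sqrt_nonneg _)
      _ = ∑ i ∈ A, √(d / (a + b)) * √(P i * Q i) := Finset.mul_sum ..
      _ ≤ ∑ i ∈ A, √(M i * Q i) := by
          refine Finset.sum_le_sum fun i _ => ?_
          rw [← Real.sqrt_mul (by positivity), ← mul_assoc]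
          exact Real.sqrt_le_sqrt (mul_le_mul_of_nonneg_right (hM i) (hQ i))
  have main : ∀ x y : S, f x = c → f y ≠ c →
      (√(a + b))⁻¹ ≤ ∑ i with x.1 i ≠ y.1 i, √((r x).1 i * (r y).1 i) := by
    intro x y hx hy
    obtain ⟨hux, hvx⟩ := (hf x).mp hx
    have hrx : r x = m x := if_pos hx
    by_cases huy : u y = c
    · have hvy : v y ≠ c := fun hvy => hy ((hf y).mpr ⟨huy, hvy⟩)
      have hry : r y = q y := by simp only [r, if_neg hy, if_pos huy]
      rw [hrx, hry]
      refine scale b (q x).1 _ _ _ hb (q y).2.1 (fun i => ?_) (hq x y (by rw [hvx]; exact hvy.symm))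
      have := mul_nonneg (by positivity : 0 ≤ a / (a + b)) ((p x).2.1 i)
      simpa [m] using this
    · have hry : r y = p y := by simp only [r, if_neg hy, if_neg huy]
      rw [hrx, hry]
      refine scale a (p x).1 _ _ _ ha (p y).2.1 (fun i => ?_)
        (hp x y (by rw [hux]; exact fun h => huy h.symm))
      have := mul_nonneg (by positivity : 0 ≤ b / (a + b)) ((q x).2.1 i)
      simpa [m] using this
  refine ⟨r, fun x y hxy => ?_⟩
  by_cases hx : f x = c
  · exact main x y hx fun hy => hxy (hx.trans hy.symm)
  · have hy : f y = c := by
      revert hx hxy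
      cases f x <;> cases f y <;> cases c <;> simp
    refine (main y x hy hx).trans (le_of_eq ?_)
    simp_rw [ne_comm (a := y.1 _), mul_comm ((r y).1 _)]

theorem BoolFormula.size_pos {n : ℕ} (φ : BoolFormula n) : 0 < φ.size := by
  induction φ with
  | pos i => exact Nat.one_pos
  | neg i => exact Nat.one_pos
  | and φ ψ h _ => exact Nat.add_pos_left h _
  | or φ ψ h _ => exact Nat.add_pos_left h _

theorem exists_overlap_of_literal {n : ℕ} {S : Set (Fin n → Bool)} {f : S → Bool} (k : Fin n)
    (hf : ∀ x y : S, f x ≠ f y → x.1 k ≠ y.1 k) :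
    ∃ p : S → stdSimplex ℝ (Fin n), ∀ x y : S, f x ≠ f y →
      1 ≤ ∑ i with x.1 i ≠ y.1 i, √((p x).1 i * (p y).1 i) := by
  refine ⟨fun _ => ⟨Pi.single k 1, single_mem_stdSimplex ℝ k⟩, fun x y hxy => ?_⟩
  refine le_trans ?_ (Finset.single_le_sum (fun i _ => Real.sqrt_nonneg _)
    (Finset.mem_filter.mpr ⟨Finset.mem_univ k, hf x y hxy⟩))
  simp

theorem BoolFormula.exists_overlap {n : ℕ} (S : Set (Fin n → Bool)) (φ : BoolFormula n) :
    ∃ p : S → stdSimplex ℝ (Fin n), ∀ x y : S, φ.eval x.1 ≠ φ.eval y.1 →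
      (√(φ.size : ℝ))⁻¹ ≤ ∑ i with x.1 i ≠ y.1 i, √((p x).1 i * (p y).1 i) := by
  induction φ with
  | pos k =>
    simpa [BoolFormula.size] using
      exists_overlap_of_literal (f := fun x : S => (BoolFormula.pos k).eval x.1) k fun _ _ h => h
  | neg k =>
    simpa [BoolFormula.size] using
      exists_overlap_of_literal (f := fun x : S => (BoolFormula.neg k).eval x.1) k
        fun _ _ h h' => h (congrArg Bool.not h')
  | and φ ψ hφ hψ =>
    simp only [BoolFormula.size, Nat.cast_add]
    -- The two gates are dual: `c` is `true` for `∧` and `false` for `∨`.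
    exact exists_overlap_of_gate (f := fun x : S => (BoolFormula.and φ ψ).eval x.1) true
      (fun x => by simp [BoolFormula.eval]) (Nat.cast_pos.mpr φ.size_pos)
      (Nat.cast_pos.mpr ψ.size_pos) hφ hψ
  | or φ ψ hφ hψ =>
    simp only [BoolFormula.size, Nat.cast_add]
    exact exists_overlap_of_gate (f := fun x : S => (BoolFormula.or φ ψ).eval x.1) false
      (fun x => by simp [BoolFormula.eval]) (Nat.cast_pos.mpr φ.size_pos)
      (Nat.cast_pos.mpr ψ.size_pos) hφ hψ

theorem sumPI_le_sqrt_of_computes {n : ℕ} {S : Set (Fin n → Bool)} {f : S → Bool}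
    {φ : BoolFormula n} (h : φ.Computes f) : sumPI f ≤ ENNReal.ofReal √(φ.size : ℝ) := by
  obtain ⟨p, hp⟩ := φ.exists_overlap S
  refine sumPI_le_of_forall_inv_le p fun x y hxy => ?_
  rw [← ENNReal.ofReal_inv_of_pos (Real.sqrt_pos.mpr (Nat.cast_pos.mpr φ.size_pos))]
  exact ENNReal.ofReal_le_ofReal (hp x y (by rwa [h x, h y]))

theorem sumPI_le_sqrt_of_formulaSize_le {n : ℕ} {S : Set (Fin n → Bool)} {f : S → Bool} {s : ℕ}
    (h : formulaSize f ≤ (s : ℕ∞)) : sumPI f ≤ ENNReal.ofReal √(s : ℝ) := by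
  -- A strict bound on the infimum yields a witness, and integrality turns `< s + 1` back into `≤
  -- s`.
  have hlt : formulaSize f < ((s + 1 : ℕ) : ℕ∞) :=
    h.trans_lt (Nat.cast_lt.mpr (Nat.lt_succ_self s))
  simp only [formulaSize, iInf_lt_iff] at hlt
  obtain ⟨φ, hφ, hs⟩ := hlt
  have hs' : φ.size ≤ s := Nat.lt_succ_iff.mp (Nat.cast_lt.mp hs)
  exact (sumPI_le_sqrt_of_computes hφ).trans
    (ENNReal.ofReal_le_ofReal (Real.sqrt_le_sqrt (Nat.cast_le.mpr hs')))

theorem exists_isApproximatedBy_of_probFormulaSize_eq {n : ℕ} {S : Set (Fin n → Bool)} {ε : ℝ}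
    {f : S → Bool} {s : ℕ} (h : probFormulaSize ε f = (s : ℕ∞)) :
    ∃ (J : Type) (g : J → S → Bool),
      IsApproximatedBy ε f g ∧ ∀ j, formulaSize (g j) ≤ (s : ℕ∞) := by
  have hlt : probFormulaSize ε f < ((s + 1 : ℕ) : ℕ∞) :=
    h.trans_lt (Nat.cast_lt.mpr (Nat.lt_succ_self s))
  simp only [probFormulaSize, iInf_lt_iff] at hlt
  obtain ⟨t, ⟨J, g, hfg, hg⟩, ht⟩ := hlt
  have ht' : t ≤ s := Nat.lt_succ_iff.mp (Nat.cast_lt.mp ht)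
  exact ⟨J, g, hfg, fun j => (hg j).trans (Nat.cast_le.mpr ht')⟩

theorem mainTheorem3 {n : ℕ} {S : Set (Fin n → Bool)} (f : S → Bool) (ε : ℝ) (hε : ε < 1 / 2) :
    (∀ (J : Type*) (g : J → S → Bool) (s : ℝ≥0∞), IsApproximatedBy ε f g →
        (∀ j, sumPI (g j) ≤ s) → sumPI f ≤ s / ENNReal.ofReal (1 - 2 * ε)) ∧
      (ENNReal.ofReal (1 - 2 * ε) * sumPI f) ^ 2 ≤ (probFormulaSize ε f : ℝ≥0∞) := by
  refine ⟨fun J g s h hg => sumPI_le_of_isApproximatedBy hε h hg, ?_⟩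
  cases hL : probFormulaSize ε f with
  | top => simp
  | coe s =>
    obtain ⟨J, g, hfg, hg⟩ := exists_isApproximatedBy_of_probFormulaSize_eq hL
    have h := ENNReal.mul_le_of_le_div' (sumPI_le_of_isApproximatedBy hε hfg fun j =>
      sumPI_le_sqrt_of_formulaSize_le (hg j))
    refine (pow_le_pow_left' h 2).trans (le_of_eq ?_)
    rw [← ENNReal.ofReal_pow (Real.sqrt_nonneg _), Real.sq_sqrt (Nat.cast_nonneg s)]
    simp
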